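/- For $(m,n)\in\mathbb{Z}^2$ let $H_{m,n}=[3m-\tfrac12,3m+\tfrac12]\times\{3n\}$ and $V_{m,n}=\{3m+\tfrac32\}\times[3n+1,3n+2]$; these pairwise disjoint segments in the Euclidean plane $\mathbb{E}^2$ are called stitches. Let $X_H$ be the set obtained from $\mathbb{E}^2$ by collapsing each stitch to a point, let $\pi:\mathbb{E}^2\to X_H$ be the quotient map, and let $d_H(a,b)$ be the infimum of $$|v-z_1|+\sum_{i=1}^{k-1}|z_i'-z_{i+1}|+|z_k'-w|$$ (which is read as $|v-w|$ if $k=0$) over all $k\ge 0$, all $v,w\in\mathbb{E}^2$ with $\pi(v)=a$ and $\pi(w)=b$, and all $z_i,z_i'$ lying in a common stitch $I_i$ for $i=1,\dots,k$, where $I_i\ne I_{i+1}$ for all $i$. Then $(X_H,d_H)$ is a metric space, the checkered smocked space. Write $\bar d_H(x,x')=d_H(\pi(x),\pi(x'))$, and let $$F(x_1,x_2)=\frac{\sqrt2}{3}\bigl(|x_1|+|x_2|\bigr)+\frac{2-\sqrt2}{3}\,\bigl||x_1|-|x_2|\bigr|,$$ which is a norm on $\mathbb{R}^2$; put $d_F(x,x')=F(x-x')$.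 A sequence of pointed metric spaces $(X_n,d_n,x_n)$ converges to $(Y,d_Y,y_0)$ in the pointed Gromov--Hausdorff sense if for every $r>0$ the closed balls $\bar B_r(x_n)$ and $\bar B_r(y_0)$ are compact and $d_{GH}(\bar B_r(x_n),\bar B_r(y_0))\to0$, the balls carrying the restricted distances. A metric space $(Y,d_Y)$ is a tangent cone at infinity of a complete metric space $(X,d)$ of infinite diameter if there are $R_n>0$ with $R_n\to\infty$ and points $x_0\in X$, $y_0\in Y$ such that $(X,d/R_n,x_0)$ converges to $(Y,d_Y,y_0)$ in the pointed Gromov--Hausdorff sense. Then the following hold. 1. $|\bar d_H(x,x')-F(x-x')|\le\frac{13+11\sqrt2}{3}$ for all $x,x'\in\mathbb{E}^2$. 2. $(X_H,d_H)$ is complete and of infinite diameter, and it has a unique tangent cone at infinity, namely the normed plane $(\mathbb{R}^2,d_F)$: this space is a tangent cone at infinity of $(X_H,d_H)$, and every tangent cone at infinity of $(X_H,d_H)$ is isometric to it. Moreover, for every base point $x_0\in X_H$ and every sequence $R_n>0$ with $R_n\to\infty$, $(X_H,d_H/R_n,x_0)$ converges to $(\mathbb{R}^2,d_F,0)$ in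 the pointed Gromov--Hausdorff sense. -/

import Mathlib

open Filter Topology

noncomputable section

namespace Smocking

/-! ### Smocked metric spaces -/

/-- A smocking pattern in Euclidean `N`-space: a finite or countable collection of connected compact
sets (the stitches), any two different ones of which are at distance at least some `δ > 0`. -/
structure Pattern (N : ℕ) where
  J : Type
  countable_J : Countable J
  stitch : J → Set (EuclideanSpace ℝ (Fin N))
  isConnected_stitch : ∀ j, IsConnected (stitch j)
  isCompact_stitch : ∀ j, IsCompact (stitch j)
  separated : ∃ δ : ℝ, 0 < δ ∧ ∀ j j', j ≠ j' → ∀ z ∈ stitch j, ∀ z' ∈ stitch j', δ ≤ dist z z'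

namespace Pattern

variable {N : ℕ} (P : Pattern N)

theorem eq_of_mem_of_mem {j j' : P.J} {z : EuclideanSpace ℝ (Fin N)}
    (h : z ∈ P.stitch j) (h' : z ∈ P.stitch j') : j = j' := by
  by_contra hne
  obtain ⟨δ, hδ, H⟩ := P.separated
  have := H j j' hne z h z h'
  simp at this
  linarith

/-- Two points are identified when they are equal or lie on a common stitch. -/
def setoid : Setoid (EuclideanSpace ℝ (Fin N)) where
  r x y := x = y ∨ ∃ j, x ∈ P.stitch j ∧ y ∈ P.stitch j
  iseqv :=
    { refl := fun _ => Or.inl rfl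
      symm := by
        rintro x y (rfl | ⟨j, hx, hy⟩)
        · exact Or.inl rfl
        · exact Or.inr ⟨j, hy, hx⟩
      trans := by
        rintro x y z (rfl | ⟨j, hx, hy⟩) (rfl | ⟨k, hy', hz⟩)
        · exact Or.inl rfl
        · exact Or.inr ⟨k, hy', hz⟩
        · exact Or.inr ⟨j, hx, hy⟩
        · obtain rfl := P.eq_of_mem_of_mem hy hy'
          exact Or.inr ⟨j, hx, hz⟩ }

/-- The smocked space: Euclidean space with each stitch viewed as a single point. -/
def Space : Type := Quotient P.setoid

/-- The smocking map. -/
def proj (x : EuclideanSpace ℝ (Fin N)) : P.Space := Quotient.mk P.setoid x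

theorem proj_eq_iff {x y : EuclideanSpace ℝ (Fin N)} :
    P.proj x = P.proj y ↔ x = y ∨ ∃ j, x ∈ P.stitch j ∧ y ∈ P.stitch j :=
  Quotient.eq (r := P.setoid)

/-- A visit to a stitch: one arrives at the point `enter` and leaves from the point `leave`
of the same stitch, at no cost. -/
structure Visit where
  idx : P.J
  enter : EuclideanSpace ℝ (Fin N)
  leave : EuclideanSpace ℝ (Fin N)
  enter_mem : enter ∈ P.stitch idx
  leave_mem : leave ∈ P.stitch idx

variable {P}

/-- The length `|v - z₁| + |z₁' - z₂| + ⋯ + |z_k' - w|` of the broken path from `v` to `w`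
with the visits `(z₁, z₁'), …, (z_k, z_k')`. -/
def chainLength : EuclideanSpace ℝ (Fin N) → List P.Visit → EuclideanSpace ℝ (Fin N) → ℝ
  | v, [], w => dist v w
  | v, s :: l, w => dist v s.enter + chainLength s.leave l w

variable (P)

/-- The lengths of all broken paths that start at a representative of `a`, end at a representative
of `b`, and visit any finite number of stitches, consecutive ones being different. -/
def lengths (a b : P.Space) : Set ℝ :=
  {L | ∃ (v w : EuclideanSpace ℝ (Fin N)) (l : List P.Visit), P.proj v = a ∧ P.proj w = b ∧
    l.IsChain (fun s t => s.idx ≠ t.idx) ∧ L = chainLength v l w}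

/-- The smocked distance function. -/
def smockedDist (a b : P.Space) : ℝ := sInf (P.lengths a b)

/-! The smocked distance function is a metric. -/

variable {P}

theorem chainLength_nonneg (v : EuclideanSpace ℝ (Fin N)) (l : List P.Visit)
    (w : EuclideanSpace ℝ (Fin N)) : 0 ≤ chainLength v l w := by
  induction l generalizing v with
  | nil => exact dist_nonneg
  | cons s l ih => exact add_nonneg dist_nonneg (ih _)

theorem chainLength_triangle (u v : EuclideanSpace ℝ (Fin N)) (l : List P.Visit)
    (w : EuclideanSpace ℝ (Fin N)) : chainLength u l w ≤ dist u v + chainLength v l w := by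
  cases l with
  | nil => exact dist_triangle _ _ _
  | cons s l =>
    simp only [chainLength]
    linarith [dist_triangle u v s.enter]

theorem chainLength_append (v u : EuclideanSpace ℝ (Fin N)) (l l' : List P.Visit)
    (w : EuclideanSpace ℝ (Fin N)) :
    chainLength v (l ++ l') w ≤ chainLength v l u + chainLength u l' w := by
  induction l generalizing v with
  | nil => exact chainLength_triangle _ _ _ _
  | cons s l ih =>
    simp only [chainLength, List.cons_append]
    linarith [ih s.leave]

theorem chainLength_append_cons (v : EuclideanSpace ℝ (Fin N)) (l l' : List P.Visit)
    (s : P.Visit) (w : EuclideanSpace ℝ (Fin N)) :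
    chainLength v (l ++ s :: l') w = chainLength v l s.enter + chainLength s.leave l' w := by
  induction l generalizing v with
  | nil => rfl
  | cons t l ih =>
    simp only [chainLength, List.cons_append, ih]
    ring

theorem exists_isChain (v : EuclideanSpace ℝ (Fin N)) (l : List P.Visit)
    (w : EuclideanSpace ℝ (Fin N)) : ∃ l' : List P.Visit,
    l'.IsChain (fun s t => s.idx ≠ t.idx) ∧ chainLength v l' w ≤ chainLength v l w := by
  induction l generalizing v with
  | nil => exact ⟨[], List.IsChain.nil, le_rfl⟩
  | cons s l ih =>
    obtain ⟨l', hl', hle⟩ := ih s.leave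
    cases l' with
    | nil =>
      refine ⟨[s], List.isChain_singleton s, ?_⟩
      simp only [chainLength] at hle ⊢
      linarith
    | cons t l' =>
      by_cases h : s.idx = t.idx
      · refine ⟨⟨s.idx, s.enter, t.leave, s.enter_mem, h ▸ t.leave_mem⟩ :: l', ?_, ?_⟩
        · cases l' with
          | nil => exact List.isChain_singleton _
          | cons r l' =>
            rw [List.isChain_cons_cons] at hl' ⊢
            exact ⟨fun e => hl'.1 (h.symm.trans e), hl'.2⟩
        · simp only [chainLength] at hle ⊢
          linarith [dist_nonneg (x := s.leave) (y := t.enter)]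
      · refine ⟨s :: t :: l', List.isChain_cons_cons.2 ⟨h, hl'⟩, ?_⟩
        simp only [chainLength] at hle ⊢
        linarith

theorem smockedDist_le {a b : P.Space} (v w : EuclideanSpace ℝ (Fin N)) (l : List P.Visit)
    (hv : P.proj v = a) (hw : P.proj w = b) : P.smockedDist a b ≤ chainLength v l w := by
  obtain ⟨l', hl', hle⟩ := exists_isChain v l w
  refine le_trans (csInf_le ⟨0, ?_⟩ ⟨v, w, l', hv, hw, hl', rfl⟩) hle
  rintro _ ⟨v, w, l, -, -, -, rfl⟩
  exact chainLength_nonneg _ _ _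

theorem le_smockedDist {a b : P.Space} {c : ℝ}
    (h : ∀ (v w : EuclideanSpace ℝ (Fin N)) (l : List P.Visit), P.proj v = a → P.proj w = b →
      c ≤ chainLength v l w) : c ≤ P.smockedDist a b := by
  refine le_csInf ?_ ?_
  · obtain ⟨v, rfl⟩ := Quotient.exists_rep a
    obtain ⟨w, rfl⟩ := Quotient.exists_rep b
    exact ⟨_, v, w, [], rfl, rfl, List.IsChain.nil, rfl⟩
  · rintro _ ⟨v, w, l, hv, hw, -, rfl⟩
    exact h v w l hv hw

theorem smockedDist_self (a : P.Space) : P.smockedDist a a = 0 := by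
  refine le_antisymm ?_ (le_smockedDist fun v w l _ _ => chainLength_nonneg v l w)
  obtain ⟨v, rfl⟩ : ∃ v, P.proj v = a := Quotient.exists_rep a
  simpa [chainLength] using smockedDist_le (P := P) v v [] rfl rfl

theorem exists_reverse (v : EuclideanSpace ℝ (Fin N)) (l : List P.Visit)
    (w : EuclideanSpace ℝ (Fin N)) :
    ∃ l' : List P.Visit, chainLength w l' v = chainLength v l w := by
  induction l generalizing v with
  | nil => exact ⟨[], dist_comm _ _⟩
  | cons s l ih =>
    obtain ⟨l', hl'⟩ := ih s.leave
    refine ⟨l' ++ [⟨s.idx, s.leave, s.enter, s.leave_mem, s.enter_mem⟩], ?_⟩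
    rw [chainLength_append_cons]
    simp only [chainLength, hl', dist_comm s.enter v]
    ring

theorem smockedDist_comm (a b : P.Space) : P.smockedDist a b = P.smockedDist b a := by
  have key : ∀ a b : P.Space, P.smockedDist a b ≤ P.smockedDist b a := fun a b =>
    le_smockedDist fun v w l hv hw => by
      obtain ⟨l', hl'⟩ := exists_reverse v l w
      exact hl' ▸ smockedDist_le w v l' hw hv
  exact le_antisymm (key a b) (key b a)

theorem smockedDist_triangle (a b c : P.Space) :
    P.smockedDist a c ≤ P.smockedDist a b + P.smockedDist b c := by
  rw [← sub_le_iff_le_add]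
  refine le_smockedDist fun v w l hv hw => ?_
  rw [sub_le_iff_le_add, ← sub_le_iff_le_add']
  refine le_smockedDist fun v' w' l' hv' hw' => ?_
  rw [sub_le_iff_le_add']
  rcases P.proj_eq_iff.1 (hw.trans hv'.symm) with rfl | ⟨j, h, h'⟩
  · exact (smockedDist_le v w' (l ++ l') hv hw').trans (chainLength_append _ _ _ _ _)
  · refine (smockedDist_le v w' (l ++ ⟨j, w, v', h, h'⟩ :: l') hv hw').trans ?_
    rw [chainLength_append_cons]

theorem min_le_chainLength {δ c : ℝ}
    (hδ : ∀ j j', j ≠ j' → ∀ z ∈ P.stitch j, ∀ z' ∈ P.stitch j', δ ≤ dist z z') {j : P.J}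
    {w : EuclideanSpace ℝ (Fin N)} (hc : ∀ z ∈ P.stitch j, c ≤ dist z w) (l : List P.Visit)
    {v : EuclideanSpace ℝ (Fin N)} (hv : v ∈ P.stitch j) : min δ c ≤ chainLength v l w := by
  induction l generalizing v with
  | nil => exact (min_le_right _ _).trans (hc v hv)
  | cons s l ih =>
    by_cases h : j = s.idx
    · exact (ih (h ▸ s.leave_mem)).trans (le_add_of_nonneg_left dist_nonneg)
    · exact ((min_le_left _ _).trans (hδ _ _ h v hv _ s.enter_mem)).trans
        (le_add_of_nonneg_right (chainLength_nonneg _ _ _))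

theorem exists_pos_le_dist {j : P.J} {w : EuclideanSpace ℝ (Fin N)} (hw : w ∉ P.stitch j) :
    ∃ c : ℝ, 0 < c ∧ ∀ z ∈ P.stitch j, c ≤ dist z w := by
  refine ⟨Metric.infDist w (P.stitch j), ?_, fun z hz => ?_⟩
  · exact ((P.isCompact_stitch j).isClosed.notMem_iff_infDist_pos (P.isConnected_stitch j).nonempty).1
      hw
  · rw [dist_comm]
    exact Metric.infDist_le_dist_of_mem hz

theorem smockedDist_pos_of_mem {j : P.J} {v w : EuclideanSpace ℝ (Fin N)}
    (hv : v ∈ P.stitch j) (hw : w ∉ P.stitch j) : 0 < P.smockedDist (P.proj v) (P.proj w) := by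
  obtain ⟨δ, hδ, H⟩ := P.separated
  obtain ⟨c, hc, hcw⟩ := exists_pos_le_dist hw
  refine lt_of_lt_of_le (lt_min hδ (lt_min hδ hc)) (le_smockedDist fun v' w' l hv' hw' => ?_)
  have hvj : v' ∈ P.stitch j := by
    rcases P.proj_eq_iff.1 hv' with rfl | ⟨k, h, h'⟩
    · exact hv
    · obtain rfl := P.eq_of_mem_of_mem hv h'
      exact h
  refine min_le_chainLength H (fun z hz => ?_) l hvj
  rcases P.proj_eq_iff.1 hw' with rfl | ⟨k, h, h'⟩
  · exact (min_le_right _ _).trans (hcw z hz)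
  · refine (min_le_left _ _).trans (H j k ?_ z hz w' h)
    rintro rfl
    exact hw h'

theorem eq_of_smockedDist_eq_zero {a b : P.Space} (h : P.smockedDist a b = 0) : a = b := by
  obtain ⟨v, rfl⟩ : ∃ v, P.proj v = a := Quotient.exists_rep a
  obtain ⟨w, rfl⟩ : ∃ w, P.proj w = b := Quotient.exists_rep b
  by_contra hne
  have hvw : ∀ j, v ∈ P.stitch j → w ∉ P.stitch j := fun j hv hw =>
    hne (P.proj_eq_iff.2 (Or.inr ⟨j, hv, hw⟩))
  by_cases hv : ∃ j, v ∈ P.stitch j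
  · obtain ⟨j, hj⟩ := hv
    exact (smockedDist_pos_of_mem hj (hvw j hj)).ne' h
  by_cases hw : ∃ j, w ∈ P.stitch j
  · obtain ⟨j, hj⟩ := hw
    rw [smockedDist_comm] at h
    exact (smockedDist_pos_of_mem hj fun h => hvw j h hj).ne' h
  push Not at hv hw
  have hd : 0 < dist v w := dist_pos.2 fun h => hne (h ▸ rfl)
  obtain ⟨δ, hδ, H⟩ := P.separated
  obtain ⟨ε, hε, hS⟩ : ∃ ε : ℝ, 0 < ε ∧ ∀ j, ∀ z ∈ P.stitch j, ε ≤ dist v z := by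
    by_cases hn : ∃ j, ∃ z ∈ P.stitch j, dist v z < δ / 2
    · obtain ⟨j, z, hz, hlt⟩ := hn
      obtain ⟨c, hc, hcw⟩ := exists_pos_le_dist (hv j)
      refine ⟨min (δ / 2) c, lt_min (half_pos hδ) hc, fun k y hy => ?_⟩
      by_cases hjk : j = k
      · subst hjk
        exact (min_le_right _ _).trans ((hcw y hy).trans_eq (dist_comm _ _))
      · refine (min_le_left _ _).trans ?_
        have h1 := H j k hjk z hz y hy
        have h2 := dist_triangle z v y
        rw [dist_comm z v] at h2
        linarith
    · push Not at hn
      exact ⟨δ / 2, half_pos hδ, fun j z hz => hn j z hz⟩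
  have : min (dist v w) ε ≤ P.smockedDist (P.proj v) (P.proj w) := by
    refine le_smockedDist fun v' w' l hv' hw' => ?_
    obtain rfl : v' = v := (P.proj_eq_iff.1 hv').resolve_right fun ⟨k, _, h'⟩ => hv k h'
    obtain rfl : w' = w := (P.proj_eq_iff.1 hw').resolve_right fun ⟨k, _, h'⟩ => hw k h'
    cases l with
    | nil => exact min_le_left _ _
    | cons s l =>
      exact ((min_le_right _ _).trans (hS _ _ s.enter_mem)).trans
        (le_add_of_nonneg_right (chainLength_nonneg _ _ _))
  have := lt_min hd hε
  linarith

instance : MetricSpace P.Space where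
  dist := P.smockedDist
  dist_self := smockedDist_self
  dist_comm := smockedDist_comm
  dist_triangle := smockedDist_triangle
  eq_of_dist_eq_zero := eq_of_smockedDist_eq_zero

variable (P)

/-- The smocking pseudometric on Euclidean space. -/
def pseudoDist (v w : EuclideanSpace ℝ (Fin N)) : ℝ := dist (P.proj v) (P.proj w)

end Pattern

/-! ### The checkered pattern -/

/-- The stitches of the checkered pattern. The index `inl (m, n)` stands for the horizontal
stitch `[3m - 1/2, 3m + 1/2] × {3n}`, and `inr (m, n)` for the vertical stitch
`{3m + 3/2} × [3n + 3/2 - 1/2, 3n + 3/2 + 1/2]`. -/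
def checkeredStitch : (ℤ × ℤ) ⊕ (ℤ × ℤ) → Set (EuclideanSpace ℝ (Fin 2))
  | .inl (m, n) => {x | x 0 ∈ Set.Icc (3 * m - 1 / 2 : ℝ) (3 * m + 1 / 2) ∧ x 1 = 3 * n}
  | .inr (m, n) => {x | x 0 = 3 * m + 3 / 2 ∧
      x 1 ∈ Set.Icc (3 * n + 3 / 2 - 1 / 2 : ℝ) (3 * n + 3 / 2 + 1 / 2)}

theorem checkeredStitch_eq_image (j : (ℤ × ℤ) ⊕ (ℤ × ℤ)) :
    ∃ (a b : ℝ) (f : ℝ → EuclideanSpace ℝ (Fin 2)), a ≤ b ∧ Continuous f ∧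
      checkeredStitch j = f '' Set.Icc a b := by
  rcases j with ⟨m, n⟩ | ⟨m, n⟩
  · refine ⟨3 * m - 1 / 2, 3 * m + 1 / 2, fun t => !₂[t, (3 * n : ℝ)], by linarith, by fun_prop,
      Set.ext fun x => ?_⟩
    constructor
    · rintro ⟨h0, h1⟩
      refine ⟨x 0, h0, ?_⟩
      ext i
      fin_cases i
      · rfl
      · exact h1.symm
    · rintro ⟨t, ht, rfl⟩
      exact ⟨ht, rfl⟩
  · refine ⟨3 * n + 3 / 2 - 1 / 2, 3 * n + 3 / 2 + 1 / 2, fun t => !₂[(3 * m + 3 / 2 : ℝ), t],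
      by linarith, by fun_prop, Set.ext fun x => ?_⟩
    constructor
    · rintro ⟨h0, h1⟩
      refine ⟨x 1, h1, ?_⟩
      ext i
      fin_cases i
      · exact h0.symm
      · rfl
    · rintro ⟨t, ht, rfl⟩
      exact ⟨rfl, ht⟩

theorem abs_sub_le_dist (x y : EuclideanSpace ℝ (Fin 2)) (i : Fin 2) : |x i - y i| ≤ dist x y := by
  rw [dist_eq_norm, ← Real.norm_eq_abs]
  exact PiLp.norm_apply_le (x - y) i

theorem int_cast_sub {m m' : ℤ} (h : m ≠ m') : (m : ℝ) + 1 ≤ m' ∨ (m' : ℝ) + 1 ≤ m := by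
  rcases lt_or_gt_of_ne h with h | h
  · left; exact_mod_cast h
  · right; exact_mod_cast h

theorem checkeredStitch_separated (j j' : (ℤ × ℤ) ⊕ (ℤ × ℤ)) (hne : j ≠ j')
    (z : EuclideanSpace ℝ (Fin 2)) (hz : z ∈ checkeredStitch j)
    (z' : EuclideanSpace ℝ (Fin 2)) (hz' : z' ∈ checkeredStitch j') : 1 ≤ dist z z' := by
  have h0 := abs_le.1 (abs_sub_le_dist z z' 0)
  have h1 := abs_le.1 (abs_sub_le_dist z z' 1)
  rcases j with ⟨m, n⟩ | ⟨m, n⟩ <;> rcases j' with ⟨m', n'⟩ | ⟨m', n'⟩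
  · obtain ⟨⟨a, b⟩, c⟩ := hz
    obtain ⟨⟨a', b'⟩, c'⟩ := hz'
    by_cases hm : m = m'
    · have hn : n ≠ n' := fun h => hne (by rw [hm, h])
      rcases int_cast_sub hn with h | h <;> linarith
    · rcases int_cast_sub hm with h | h <;> linarith
  · obtain ⟨⟨a, b⟩, c⟩ := hz
    obtain ⟨a', b', c'⟩ := hz'
    rcases le_or_gt m m' with h | h
    · have : (m : ℝ) ≤ m' := by exact_mod_cast h
      linarith
    · have : (m' : ℝ) + 1 ≤ m := by exact_mod_cast h
      linarith
  · obtain ⟨a, b, c⟩ := hz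
    obtain ⟨⟨a', b'⟩, c'⟩ := hz'
    rcases le_or_gt m' m with h | h
    · have : (m' : ℝ) ≤ m := by exact_mod_cast h
      linarith
    · have : (m : ℝ) + 1 ≤ m' := by exact_mod_cast h
      linarith
  · obtain ⟨a, b, c⟩ := hz
    obtain ⟨a', b', c'⟩ := hz'
    by_cases hm : m = m'
    · have hn : n ≠ n' := fun h => hne (by rw [hm, h])
      rcases int_cast_sub hn with h | h <;> linarith
    · rcases int_cast_sub hm with h | h <;> linarith

/-- The checkered smocking pattern. -/
def checkered : Pattern 2 where
  J := (ℤ × ℤ) ⊕ (ℤ × ℤ)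
  countable_J := inferInstance
  stitch := checkeredStitch
  isConnected_stitch j := by
    obtain ⟨a, b, f, hab, hf, h⟩ := checkeredStitch_eq_image j
    exact h ▸ (isConnected_Icc hab).image f hf.continuousOn
  isCompact_stitch j := by
    obtain ⟨a, b, f, -, hf, h⟩ := checkeredStitch_eq_image j
    exact h ▸ isCompact_Icc.image hf
  separated := ⟨1, one_pos, checkeredStitch_separated⟩

/-- The checkered smocked space, with its smocked metric. -/
abbrev CheckeredSpace : Type := checkered.Space

/-! ### The normed plane -/

/-- The function `F`. -/
def F (x : EuclideanSpace ℝ (Fin 2)) : ℝ :=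
  √2 / 3 * (|x 0| + |x 1|) + (2 - √2) / 3 * |(|x 0| - |x 1|)|

theorem F_eq_max (x : EuclideanSpace ℝ (Fin 2)) :
    F x = max (2 / 3 * |x 0| + (2 * √2 - 2) / 3 * |x 1|)
      ((2 * √2 - 2) / 3 * |x 0| + 2 / 3 * |x 1|) := by
  have h2 : √2 < 2 := by
    rw [Real.sqrt_lt' two_pos]
    norm_num
  unfold F
  rcases le_total |x 0| |x 1| with h | h
  · rw [abs_of_nonpos (sub_nonpos.2 h), max_eq_right (by nlinarith)]
    ring
  · rw [abs_of_nonneg (sub_nonneg.2 h), max_eq_left (by nlinarith)]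
    ring

/-- The plane with the vector space structure of `ℝ²`, to be normed by `F`. -/
def FPlane : Type := EuclideanSpace ℝ (Fin 2)

instance : AddCommGroup FPlane := inferInstanceAs (AddCommGroup (EuclideanSpace ℝ (Fin 2)))

instance : Module ℝ FPlane := inferInstanceAs (Module ℝ (EuclideanSpace ℝ (Fin 2)))

instance : Norm FPlane := ⟨F⟩

theorem FPlane.core : NormedSpace.Core ℝ FPlane where
  norm_nonneg (x : EuclideanSpace ℝ (Fin 2)) := by
    change 0 ≤ F x
    have h1 : 1 ≤ √2 := Real.one_le_sqrt.2 one_le_two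
    rw [F_eq_max]
    refine le_max_of_le_left ?_
    have : 0 ≤ (2 * √2 - 2) / 3 := by linarith
    positivity
  norm_smul c (x : EuclideanSpace ℝ (Fin 2)) := by
    change F (c • x) = |c| * F x
    simp only [F, PiLp.smul_apply, smul_eq_mul, abs_mul, ← mul_sub, abs_abs]
    ring
  norm_triangle (x y : EuclideanSpace ℝ (Fin 2)) := by
    change F (x + y) ≤ F x + F y
    have h1 : 0 ≤ (2 * √2 - 2) / 3 := by linarith [Real.one_le_sqrt.2 (one_le_two (α := ℝ))]
    simp only [F_eq_max, PiLp.add_apply]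
    have e0 := abs_add_le (x 0) (y 0)
    have e1 := abs_add_le (x 1) (y 1)
    have f0 := mul_le_mul_of_nonneg_left e0 h1
    have f1 := mul_le_mul_of_nonneg_left e1 h1
    refine max_le ?_ ?_
    · refine le_trans ?_ (add_le_add (le_max_left _ _) (le_max_left _ _))
      linarith
    · refine le_trans ?_ (add_le_add (le_max_right _ _) (le_max_right _ _))
      linarith
  norm_eq_zero_iff (x : EuclideanSpace ℝ (Fin 2)) := by
    change F x = 0 ↔ x = 0
    constructor
    · intro h
      have h1 : 1 ≤ √2 := Real.one_le_sqrt.2 one_le_two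
      have h0 : 0 ≤ (2 * √2 - 2) / 3 := by linarith
      have hl := (le_max_left _ _).trans_eq ((F_eq_max x).symm.trans h)
      have hr := (le_max_right _ _).trans_eq ((F_eq_max x).symm.trans h)
      have p0 := mul_nonneg h0 (abs_nonneg (x 0))
      have p1 := mul_nonneg h0 (abs_nonneg (x 1))
      ext i
      fin_cases i
      · exact abs_nonpos_iff.1 (by linarith : |x 0| ≤ 0)
      · exact abs_nonpos_iff.1 (by linarith : |x 1| ≤ 0)
    · rintro rfl
      simp [F]

instance : NormedAddCommGroup FPlane := NormedAddCommGroup.ofCore FPlane.core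

instance : NormedSpace ℝ FPlane := NormedSpace.ofCore FPlane.core

theorem FPlane.dist_eq (x y : EuclideanSpace ℝ (Fin 2)) :
    dist (α := FPlane) x y = F (x - y) :=
  dist_eq_norm (E := FPlane) x y

/-! ### Tangent cones at infinity -/

/-- The set `X` with the rescaled distance `d / R`. -/
def Rescaled (X : Type*) (_R : {R : ℝ // 0 < R}) : Type _ := X

instance (X : Type*) [MetricSpace X] (R : {R : ℝ // 0 < R}) : MetricSpace (Rescaled X R) where
  dist x y := dist (α := X) x y / R
  dist_self x := by simp [dist_self (α := X) x]
  dist_comm x y := by rw [dist_comm (α := X) x y]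
  dist_triangle x y z := by
    rw [← add_div]
    exact div_le_div_of_nonneg_right (dist_triangle (α := X) x y z) R.2.le
  eq_of_dist_eq_zero {x y} h :=
    eq_of_dist_eq_zero (γ := X) ((div_eq_zero_iff.1 h).resolve_right R.2.ne')

/-- Gromov-Hausdorff convergence of a sequence of (nonempty) compact metric spaces to a compact
metric space. -/
def GHConverges (A : ℕ → Type*) [∀ n, MetricSpace (A n)] (B : Type*) [MetricSpace B] : Prop :=
  ∃ (_ : ∀ n, Nonempty (A n)) (_ : ∀ n, CompactSpace (A n)) (_ : Nonempty B) (_ : CompactSpace B),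
    Tendsto (fun n => GromovHausdorff.ghDist (A n) B) atTop (𝓝 0)

/-- Pointed Gromov-Hausdorff convergence: for every radius, the closed balls converge. -/
def PtGHConverges (X : ℕ → Type*) [∀ n, MetricSpace (X n)] (x : ∀ n, X n)
    (Y : Type*) [MetricSpace Y] (y : Y) : Prop :=
  ∀ r : ℝ, 0 < r →
    GHConverges (fun n => Metric.closedBall (x n) r) (Metric.closedBall y r)

/-- `Y` is a tangent cone at infinity of the complete metric space `X` of infinite diameter
(which is then not compact). -/
def IsTangentConeAtInfinity (X : Type*) [MetricSpace X] (Y : Type*) [MetricSpace Y] : Prop :=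
  CompleteSpace X ∧ ¬ Bornology.IsBounded (Set.univ : Set X) ∧
    ∃ (R : ℕ → {R : ℝ // 0 < R}) (x₀ : X) (y₀ : Y),
      Tendsto (fun n => (R n : ℝ)) atTop atTop ∧
      PtGHConverges (fun n => Rescaled X (R n)) (fun _ => x₀) Y y₀

end Smocking

end

namespace Smocking

/-! The norm `F` records the cheapest way to travel along the grid of stitches. A displacement by
(3,0) costs 2 between neighbouring horizontal stitches, one by (0,3) costs 2 between neighbouring
vertical stitches, and one by (3,3) costs 2√2 through a vertical stitch in between. `F` takes
exactly these values, and in each octant it is linear.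

Lower bound: `F` is at most the Euclidean norm, and the gap between two stitches is at least `F` of
the difference of their midpoints (`F_stitchCenter_sub_le_dist`). Measured from midpoint to
midpoint, the `F`-displacement along a broken path therefore telescopes against its length, and only
the ends cause a bounded loss (`F_sub_le_chainLength`).

Upper bound: between horizontal stitches one goes diagonally as far as possible and then straight,
at cost `F` plus a constant (`dist_stitchPoint_le_F`). Every point is close to a horizontal stitch.

A choice of representatives is then an isometry up to a constant, and almost onto the plane normed
by `F`. Dividing by R makes the error tend to zero (`ptGHConverges_rescaled_of_coarse_isometry`).
For uniqueness, closed balls of equal radius in two limits are isometric. In a normed space the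
centre of a ball is determined by its metric, so these isometries preserve base points, and an
ultrafilter limit of them is a global isometry (`PtGHConverges.nonempty_isometryEquiv`). -/

/-! ### The norm `F` compared with the Euclidean norm -/

theorem sqrt_two_bounds : 1.41 < √2 ∧ √2 < 1.42 := by
  constructor
  · rw [Real.lt_sqrt (by norm_num)]; norm_num
  · rw [Real.sqrt_lt' (by norm_num)]; norm_num

/-- Since `F` is a maximum of two forms linear in the absolute values, upper bounds on it become
linear inequalities, ready for `linarith`. -/
theorem F_le_iff {x : EuclideanSpace ℝ (Fin 2)} {c : ℝ} :
    F x ≤ c ↔ 2 * |x 0| + (2 * √2 - 2) * |x 1| ≤ 3 * c ∧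
      (2 * √2 - 2) * |x 0| + 2 * |x 1| ≤ 3 * c := by
  rw [F_eq_max, max_le_iff]
  constructor <;> rintro ⟨h, h'⟩ <;> constructor <;> linarith

theorem F_add_le (x y : EuclideanSpace ℝ (Fin 2)) : F (x + y) ≤ F x + F y :=
  FPlane.core.norm_triangle x y

theorem F_neg (x : EuclideanSpace ℝ (Fin 2)) : F (-x) = F x := by simp [F]

theorem F_sub_comm (x y : EuclideanSpace ℝ (Fin 2)) : F (x - y) = F (y - x) := by
  rw [← F_neg, neg_sub]

theorem F_sub_le (x y z : EuclideanSpace ℝ (Fin 2)) : F (x - z) ≤ F (x - y) + F (y - z) := by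
  simpa using F_add_le (x - y) (y - z)

theorem F_nonneg (x : EuclideanSpace ℝ (Fin 2)) : 0 ≤ F x := FPlane.core.norm_nonneg x

theorem abs_add_abs_le_dist (x y : EuclideanSpace ℝ (Fin 2)) :
    |x 0 - y 0| + |x 1 - y 1| ≤ √2 * dist x y := by
  rw [EuclideanSpace.dist_eq, Fin.sum_univ_two, ← Real.sqrt_mul zero_le_two]
  refine Real.le_sqrt_of_sq_le ?_
  simp only [Real.dist_eq]
  nlinarith [sq_nonneg (|x 0 - y 0| - |x 1 - y 1|)]

theorem dist_le_of_abs_le {x y : EuclideanSpace ℝ (Fin 2)} {a b c : ℝ} (hc : 0 ≤ c)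
    (h0 : |x 0 - y 0| ≤ a) (h1 : |x 1 - y 1| ≤ b) (h : a ^ 2 + b ^ 2 ≤ c ^ 2) :
    dist x y ≤ c := by
  rw [EuclideanSpace.dist_eq, Fin.sum_univ_two]
  refine Real.sqrt_le_iff.2 ⟨hc, le_trans ?_ h⟩
  simp only [Real.dist_eq]
  gcongr

/-- Each coordinate difference is at most the distance, and the two coefficients in either linear
form add up to 2√2 < 3. -/
theorem F_le_dist (x y : EuclideanSpace ℝ (Fin 2)) : F (x - y) ≤ dist x y := by
  obtain ⟨h1, h2⟩ := sqrt_two_bounds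
  rw [F_le_iff]
  have a0 := abs_sub_le_dist x y 0
  have a1 := abs_sub_le_dist x y 1
  have b : 0 ≤ 2 * √2 - 2 := by linarith
  have b0 := mul_le_mul_of_nonneg_left a0 b
  have b1 := mul_le_mul_of_nonneg_left a1 b
  have b2 := mul_le_mul_of_nonneg_right h2.le (dist_nonneg (x := x) (y := y))
  simp only [PiLp.sub_apply]
  constructor <;> linarith [dist_nonneg (x := x) (y := y)]

/-! ### Lower bound for the smocked distance -/

/-- The midpoint of a stitch of the checkered pattern. -/
noncomputable def stitchCenter : (ℤ × ℤ) ⊕ (ℤ × ℤ) → EuclideanSpace ℝ (Fin 2)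
  | .inl (m, n) => !₂[(3 * m : ℝ), 3 * n]
  | .inr (m, n) => !₂[(3 * m + 3 / 2 : ℝ), 3 * n + 3 / 2]

theorem stitchCenter_mem (j : (ℤ × ℤ) ⊕ (ℤ × ℤ)) : stitchCenter j ∈ checkeredStitch j := by
  rcases j with ⟨m, n⟩ | ⟨m, n⟩
  · simp [stitchCenter, checkeredStitch]
  · refine ⟨by simp [stitchCenter], ?_, ?_⟩ <;> simp [stitchCenter]

theorem abs_sub_stitchCenter_le {j : (ℤ × ℤ) ⊕ (ℤ × ℤ)} {z : EuclideanSpace ℝ (Fin 2)}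
    (hz : z ∈ checkeredStitch j) :
    (|z 0 - stitchCenter j 0| ≤ 1 / 2 ∧ z 1 - stitchCenter j 1 = 0) ∨
      (z 0 - stitchCenter j 0 = 0 ∧ |z 1 - stitchCenter j 1| ≤ 1 / 2) := by
  rcases j with ⟨m, n⟩ | ⟨m, n⟩
  · obtain ⟨⟨a, b⟩, c⟩ := hz
    left
    simp only [stitchCenter, abs_le, PiLp.toLp_apply, Matrix.cons_val_zero, Matrix.cons_val_one]
    exact ⟨⟨by linarith, by linarith⟩, by linarith⟩
  · obtain ⟨a, b, c⟩ := hz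
    right
    simp only [stitchCenter, abs_le, PiLp.toLp_apply, Matrix.cons_val_zero, Matrix.cons_val_one]
    exact ⟨by linarith, by linarith, by linarith⟩

theorem F_sub_stitchCenter_le {j : (ℤ × ℤ) ⊕ (ℤ × ℤ)} {z : EuclideanSpace ℝ (Fin 2)}
    (hz : z ∈ checkeredStitch j) : F (z - stitchCenter j) ≤ 1 / 3 := by
  obtain ⟨h1, h2⟩ := sqrt_two_bounds
  rw [F_le_iff]
  simp only [PiLp.sub_apply]
  rcases abs_sub_stitchCenter_le hz with ⟨a, b⟩ | ⟨a, b⟩ <;>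
    simp only [a, b, abs_zero] <;> constructor <;> nlinarith

/-- Two parallel stitches: `s` and `t` are the differences of the midpoints along and across the
stitches, and `d` is a distance between points of them. The stitches shorten `s` by at most 1. If `s
= 0` or `t = 0`, a single coordinate suffices, because |s| - 1 ≥ 2|s|/3 once |s| ≥ 3; otherwise both
are at least 3 and `hd` has room to spare. -/
theorem F_parallel_le {s t d : ℝ} {p : ℤ} (hs : |s| = 3 * |(p : ℝ)|) (h0 : |s| - 1 ≤ d)
    (h1 : |t| ≤ d) (ht : t = 0 ∨ 3 ≤ |t|) (hd : |s| - 1 + |t| ≤ √2 * d) :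
    2 * |s| + (2 * √2 - 2) * |t| ≤ 3 * d ∧ (2 * √2 - 2) * |s| + 2 * |t| ≤ 3 * d := by
  obtain ⟨e1, e2⟩ := sqrt_two_bounds
  have e3 : √2 * √2 = 2 := Real.mul_self_sqrt zero_le_two
  have hd' : √2 * (|s| - 1 + |t|) ≤ 2 * d := by
    have := mul_le_mul_of_nonneg_left hd (Real.sqrt_nonneg 2)
    linarith [mul_assoc √2 √2 d, e3 ▸ mul_assoc √2 √2 d]
  have t0 := abs_nonneg t
  by_cases hp : p = 0
  · simp only [hp, Int.cast_zero, abs_zero, mul_zero] at hs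
    rw [hs]
    constructor <;> nlinarith
  · have hp' : (1 : ℝ) ≤ |(p : ℝ)| := by exact_mod_cast Int.one_le_abs hp
    have hs3 : 3 ≤ |s| := by linarith
    rcases ht with rfl | ht
    · simp only [abs_zero] at *
      constructor <;> nlinarith
    · constructor <;> nlinarith

/-- A horizontal and a vertical stitch: each coordinate is shortened by at most 1/2. The derived
bound is sharp at |s| = |t| = 3/2, the case of neighbouring stitches, where both sides equal 3√2
when d = √2. In both variables the lower bound for 3d grows faster. -/
theorem F_transverse_le {s t d : ℝ} (hs : 3 / 2 ≤ |s|) (ht : 3 / 2 ≤ |t|)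
    (hd : |s| - 1 / 2 + (|t| - 1 / 2) ≤ √2 * d) :
    2 * |s| + (2 * √2 - 2) * |t| ≤ 3 * d ∧ (2 * √2 - 2) * |s| + 2 * |t| ≤ 3 * d := by
  obtain ⟨e1, e2⟩ := sqrt_two_bounds
  have e3 : √2 * √2 = 2 := Real.mul_self_sqrt zero_le_two
  have hd' : √2 * (|s| - 1 / 2 + (|t| - 1 / 2)) ≤ 2 * d := by
    have := mul_le_mul_of_nonneg_left hd (Real.sqrt_nonneg 2)
    linarith [mul_assoc √2 √2 d, e3 ▸ mul_assoc √2 √2 d]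
  constructor
  · nlinarith [mul_nonneg (sub_nonneg.2 hs) (sub_nonneg.2 e1.le),
      mul_nonneg (sub_nonneg.2 ht) (sub_nonneg.2 e2.le)]
  · nlinarith [mul_nonneg (sub_nonneg.2 ht) (sub_nonneg.2 e1.le),
      mul_nonneg (sub_nonneg.2 hs) (sub_nonneg.2 e2.le)]

theorem eq_zero_or_three_le (p : ℤ) : 3 * (p : ℝ) = 0 ∨ 3 ≤ |3 * (p : ℝ)| := by
  by_cases hp : p = 0
  · simp [hp]
  · have hp' : (1 : ℝ) ≤ |(p : ℝ)| := by exact_mod_cast Int.one_le_abs hp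
    right
    rw [abs_mul, abs_of_nonneg (by norm_num : (0 : ℝ) ≤ 3)]
    linarith

theorem three_halves_le_abs (p : ℤ) : 3 / 2 ≤ |3 * (p : ℝ) + 3 / 2| := by
  rcases le_or_gt 0 p with hp | hp
  · have : (0 : ℝ) ≤ p := by exact_mod_cast hp
    exact le_trans (by linarith) (le_abs_self _)
  · have : (p : ℝ) + 1 ≤ 0 := by exact_mod_cast hp
    exact le_trans (by linarith) (neg_le_abs _)

/-- Different stitches are at least as far apart as the norm `F` of the difference of their
midpoints. -/
theorem F_stitchCenter_sub_le_dist (j j' : (ℤ × ℤ) ⊕ (ℤ × ℤ)) {z z' : EuclideanSpace ℝ (Fin 2)}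
    (hz : z ∈ checkeredStitch j) (hz' : z' ∈ checkeredStitch j') :
    F (stitchCenter j - stitchCenter j') ≤ dist z z' := by
  have a0 := abs_sub_le_dist z z' 0
  have a1 := abs_sub_le_dist z z' 1
  have a2 := abs_add_abs_le_dist z z'
  rw [F_le_iff]
  rcases j with ⟨m, n⟩ | ⟨m, n⟩ <;> rcases j' with ⟨m', n'⟩ | ⟨m', n'⟩ <;>
    simp only [stitchCenter, PiLp.sub_apply, Matrix.cons_val_zero, Matrix.cons_val_one]
  · obtain ⟨⟨a, b⟩, c⟩ := hz
    obtain ⟨⟨a', b'⟩, c'⟩ := hz'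
    have k0 : |(3 * m - 3 * m' : ℝ)| - 1 ≤ |z 0 - z' 0| := by
      rcases abs_cases (3 * m - 3 * m' : ℝ) with h | h <;>
        rcases abs_cases (z 0 - z' 0) with h' | h' <;> linarith
    have e : (3 * m - 3 * m' : ℝ) = 3 * ((m - m' : ℤ) : ℝ) := by push_cast; ring
    have e' : (3 * n - 3 * n' : ℝ) = 3 * ((n - n' : ℤ) : ℝ) := by push_cast; ring
    rw [c, c'] at a1 a2
    refine F_parallel_le (p := m - m') ?_ (by linarith) a1 ?_ (by linarith)
    · rw [e, abs_mul, abs_of_nonneg (by norm_num : (0 : ℝ) ≤ 3)]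
    · rw [e']; exact eq_zero_or_three_le _
  · obtain ⟨⟨a, b⟩, c⟩ := hz
    obtain ⟨a', b', c'⟩ := hz'
    have e : (3 * m - (3 * m' + 3 / 2) : ℝ) = 3 * ((m - m' - 1 : ℤ) : ℝ) + 3 / 2 := by
      push_cast; ring
    have e' : (3 * n - (3 * n' + 3 / 2) : ℝ) = 3 * ((n - n' - 1 : ℤ) : ℝ) + 3 / 2 := by
      push_cast; ring
    refine F_transverse_le (e ▸ three_halves_le_abs _) (e' ▸ three_halves_le_abs _) (le_trans ?_ a2)
    refine add_le_add ?_ ?_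
    · rcases abs_cases (3 * m - (3 * m' + 3 / 2) : ℝ) with h | h <;>
        rcases abs_cases (z 0 - z' 0) with h' | h' <;> linarith
    · rcases abs_cases (3 * n - (3 * n' + 3 / 2) : ℝ) with h | h <;>
        rcases abs_cases (z 1 - z' 1) with h' | h' <;> linarith
  · obtain ⟨a, b, c⟩ := hz
    obtain ⟨⟨a', b'⟩, c'⟩ := hz'
    have e : (3 * m + 3 / 2 - 3 * m' : ℝ) = 3 * ((m - m' : ℤ) : ℝ) + 3 / 2 := by
      push_cast; ring
    have e' : (3 * n + 3 / 2 - 3 * n' : ℝ) = 3 * ((n - n' : ℤ) : ℝ) + 3 / 2 := by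
      push_cast; ring
    refine F_transverse_le (e ▸ three_halves_le_abs _) (e' ▸ three_halves_le_abs _) (le_trans ?_ a2)
    refine add_le_add ?_ ?_
    · rcases abs_cases (3 * m + 3 / 2 - 3 * m' : ℝ) with h | h <;>
        rcases abs_cases (z 0 - z' 0) with h' | h' <;> linarith
    · rcases abs_cases (3 * n + 3 / 2 - 3 * n' : ℝ) with h | h <;>
        rcases abs_cases (z 1 - z' 1) with h' | h' <;> linarith
  · obtain ⟨a, b, c⟩ := hz
    obtain ⟨a', b', c'⟩ := hz'
    have k1 : |(3 * n + 3 / 2 - (3 * n' + 3 / 2) : ℝ)| - 1 ≤ |z 1 - z' 1| := by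
      rcases abs_cases (3 * n + 3 / 2 - (3 * n' + 3 / 2) : ℝ) with h | h <;>
        rcases abs_cases (z 1 - z' 1) with h' | h' <;> linarith
    have e : (3 * m + 3 / 2 - (3 * m' + 3 / 2) : ℝ) = 3 * ((m - m' : ℤ) : ℝ) := by
      push_cast; ring
    have e' : (3 * n + 3 / 2 - (3 * n' + 3 / 2) : ℝ) = 3 * ((n - n' : ℤ) : ℝ) := by
      push_cast; ring
    rw [a, a'] at a0 a2
    -- For vertical stitches the coordinates exchange roles, so the two resulting inequalities are
    -- those of the goal in exchanged order.
    have := F_parallel_le (p := n - n') (s := 3 * n + 3 / 2 - (3 * n' + 3 / 2))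
      (t := 3 * m + 3 / 2 - (3 * m' + 3 / 2)) (d := dist z z') ?_ (by linarith) a0 ?_ (by linarith)
    · constructor <;> linarith [this.1, this.2]
    · rw [e', abs_mul, abs_of_nonneg (by norm_num : (0 : ℝ) ≤ 3)]
    · rw [e]; exact eq_zero_or_three_le _

/-- Telescoping from midpoint to midpoint makes the error independent of the number of visits. The
1/3 is lost only once, on leaving the last stitch. -/
theorem F_stitchCenter_sub_le_chainLength (j : (ℤ × ℤ) ⊕ (ℤ × ℤ))
    {v : EuclideanSpace ℝ (Fin 2)} (hv : v ∈ checkeredStitch j) (l : List checkered.Visit)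
    (w : EuclideanSpace ℝ (Fin 2)) :
    F (stitchCenter j - w) - 1 / 3 ≤ Pattern.chainLength v l w := by
  induction l generalizing v j with
  | nil =>
    simp only [Pattern.chainLength]
    have h1 := F_sub_le (stitchCenter j) v w
    have h2 := F_sub_stitchCenter_le hv
    rw [F_sub_comm] at h2
    linarith [F_le_dist v w]
  | cons s l ih =>
    simp only [Pattern.chainLength]
    have h1 := ih s.idx s.leave_mem
    have h2 := F_stitchCenter_sub_le_dist j s.idx hv s.enter_mem
    linarith [F_sub_le (stitchCenter j) (stitchCenter s.idx) w]

theorem F_sub_le_chainLength (v : EuclideanSpace ℝ (Fin 2)) (l : List checkered.Visit)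
    (w : EuclideanSpace ℝ (Fin 2)) : F (v - w) - 2 / 3 ≤ Pattern.chainLength v l w := by
  cases l with
  | nil =>
    simp only [Pattern.chainLength]
    linarith [F_le_dist v w]
  | cons s l =>
    simp only [Pattern.chainLength]
    have h1 := F_stitchCenter_sub_le_chainLength s.idx s.leave_mem l w
    have h2 := F_sub_stitchCenter_le s.enter_mem
    have h3 := F_sub_le v s.enter w
    have h4 := F_sub_le s.enter (stitchCenter s.idx) w
    linarith [F_le_dist v s.enter]

theorem F_sub_le_of_proj_eq {v x : EuclideanSpace ℝ (Fin 2)}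
    (h : checkered.proj v = checkered.proj x) : F (v - x) ≤ 2 / 3 := by
  rcases checkered.proj_eq_iff.1 h with rfl | ⟨j, hv, hx⟩
  · rw [sub_self]
    norm_num [F]
  · have h1 := F_sub_stitchCenter_le hv
    have h2 := F_sub_stitchCenter_le hx
    rw [F_sub_comm] at h2
    linarith [F_sub_le v (stitchCenter j) x]

theorem F_sub_le_pseudoDist (x x' : EuclideanSpace ℝ (Fin 2)) :
    F (x - x') - 2 ≤ checkered.pseudoDist x x' := by
  refine Pattern.le_smockedDist fun v w l hv hw => ?_
  have h1 := F_sub_le_of_proj_eq hv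
  have h2 := F_sub_le_of_proj_eq hw
  rw [F_sub_comm] at h1
  -- The constant 2 is 2/3 for each change of representative plus 2/3 for the path.
  linarith [F_sub_le x v x', F_sub_le v w x', F_sub_le_chainLength v l w]

/-! ### Upper bound for the smocked distance -/

theorem dist_le_mul_abs_sub {X : Type*} [PseudoMetricSpace X] {f : ℤ → X} {c : ℝ}
    (h : ∀ i, dist (f i) (f (i + 1)) ≤ c) (i j : ℤ) : dist (f i) (f j) ≤ c * |(j - i : ℝ)| := by
  have key : ∀ (i : ℤ) (k : ℕ), dist (f i) (f (i + k)) ≤ c * k := by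
    intro i k
    induction k with
    | zero => simp
    | succ k ih =>
      have := dist_triangle (f i) (f (i + k)) (f (i + k + 1))
      push_cast
      rw [← add_assoc]
      linarith [h (i + k)]
  rcases le_total i j with hij | hij
  · obtain ⟨k, rfl⟩ := Int.le.dest hij
    simpa using key i k
  · obtain ⟨k, rfl⟩ := Int.le.dest hij
    rw [dist_comm]
    simpa using key j k

/-- The point of the smocked space represented by a stitch. -/
noncomputable def stitchPoint (j : (ℤ × ℤ) ⊕ (ℤ × ℤ)) : CheckeredSpace :=
  checkered.proj (stitchCenter j)

theorem proj_eq_stitchPoint {j : (ℤ × ℤ) ⊕ (ℤ × ℤ)} {z : EuclideanSpace ℝ (Fin 2)}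
    (hz : z ∈ checkeredStitch j) : checkered.proj z = stitchPoint j :=
  checkered.proj_eq_iff.2 (Or.inr ⟨j, hz, stitchCenter_mem j⟩)

theorem dist_proj_le (x y : EuclideanSpace ℝ (Fin 2)) :
    dist (checkered.proj x) (checkered.proj y) ≤ dist x y :=
  Pattern.smockedDist_le x y [] rfl rfl

theorem dist_stitchPoint_le {j j' : (ℤ × ℤ) ⊕ (ℤ × ℤ)} {z z' : EuclideanSpace ℝ (Fin 2)}
    (hz : z ∈ checkeredStitch j) (hz' : z' ∈ checkeredStitch j') :
    dist (stitchPoint j) (stitchPoint j') ≤ dist z z' := by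
  rw [← proj_eq_stitchPoint hz, ← proj_eq_stitchPoint hz']
  exact dist_proj_le z z'

theorem dist_horizontal_succ (m n : ℤ) :
    dist (stitchPoint (.inl (m, n))) (stitchPoint (.inl (m + 1, n))) ≤ 2 := by
  refine (dist_stitchPoint_le (z := !₂[(3 * m + 1 / 2 : ℝ), 3 * n])
    (z' := !₂[(3 * m + 5 / 2 : ℝ), 3 * n]) ?_ ?_).trans
    (dist_le_of_abs_le (a := 2) (b := 0) zero_le_two ?_ ?_ (by norm_num))
  · refine ⟨⟨?_, ?_⟩, ?_⟩ <;> simp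
    linarith
  · refine ⟨⟨?_, ?_⟩, ?_⟩ <;> simp <;> linarith
  · rw [abs_le]; constructor <;> simp <;> linarith
  · simp

theorem dist_vertical_succ (m n : ℤ) :
    dist (stitchPoint (.inr (m, n))) (stitchPoint (.inr (m, n + 1))) ≤ 2 := by
  refine (dist_stitchPoint_le (z := !₂[(3 * m + 3 / 2 : ℝ), 3 * n + 2])
    (z' := !₂[(3 * m + 3 / 2 : ℝ), 3 * n + 4]) ?_ ?_).trans
    (dist_le_of_abs_le (a := 0) (b := 2) zero_le_two ?_ ?_ (by norm_num))
  · refine ⟨?_, ?_, ?_⟩ <;> simp <;> linarith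
  · refine ⟨?_, ?_, ?_⟩ <;> simp <;> linarith
  · simp
  · rw [abs_le]; constructor <;> simp
    linarith

/-- The signs `s`, `t` select one of the four vertical stitches around a horizontal one. The facing
endpoints differ by 1 in each coordinate. -/
theorem dist_horizontal_vertical_le {m n m' n' : ℤ} {s t : ℝ} (hs : s ^ 2 = 1) (ht : t ^ 2 = 1)
    (hm : (m' : ℝ) = m + (s - 1) / 2) (hn : (n' : ℝ) = n + (t - 1) / 2) :
    dist (stitchPoint (.inl (m, n))) (stitchPoint (.inr (m', n'))) ≤ √2 := by
  have hs' := abs_le_one_iff_mul_self_le_one.2 (by linarith : s * s ≤ 1)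
  have ht' := abs_le_one_iff_mul_self_le_one.2 (by linarith : t * t ≤ 1)
  have e := abs_le.1 hs'
  have e' := abs_le.1 ht'
  refine (dist_stitchPoint_le (z := !₂[(3 * m + s / 2 : ℝ), 3 * n])
    (z' := !₂[(3 * m' + 3 / 2 : ℝ), 3 * n + t]) ?_ ?_).trans
    (dist_le_of_abs_le (a := 1) (b := 1) (Real.sqrt_nonneg 2) ?_ ?_ (by norm_num))
  · refine ⟨⟨?_, ?_⟩, ?_⟩ <;> simp <;> linarith
  · refine ⟨?_, ?_, ?_⟩ <;> simp <;> linarith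
  · rw [abs_le]; constructor <;> simp <;> linarith
  · simpa using ht'

theorem dist_diagonal_succ (m n : ℤ) :
    dist (stitchPoint (.inl (m, n))) (stitchPoint (.inl (m + 1, n + 1))) ≤ 2 * √2 := by
  have h1 := dist_horizontal_vertical_le (m := m) (n := n) (m' := m) (n' := n) (s := 1) (t := 1)
    (by norm_num) (by norm_num) (by simp) (by simp)
  have h2 := dist_horizontal_vertical_le (m := m + 1) (n := n + 1) (m' := m) (n' := n) (s := -1)
    (t := -1) (by norm_num) (by norm_num) (by push_cast; ring) (by push_cast; ring)
  rw [dist_comm] at h2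
  linarith [dist_triangle (stitchPoint (.inl (m, n))) (stitchPoint (.inr (m, n)))
    (stitchPoint (.inl (m + 1, n + 1)))]

theorem dist_antidiagonal_succ (m n : ℤ) :
    dist (stitchPoint (.inl (m, n))) (stitchPoint (.inl (m + 1, n - 1))) ≤ 2 * √2 := by
  have h1 := dist_horizontal_vertical_le (m := m) (n := n) (m' := m) (n' := n - 1) (s := 1)
    (t := -1) (by norm_num) (by norm_num) (by simp) (by push_cast; ring)
  have h2 := dist_horizontal_vertical_le (m := m + 1) (n := n - 1) (m' := m) (n' := n - 1)
    (s := -1) (t := 1) (by norm_num) (by norm_num) (by push_cast; ring) (by push_cast; ring)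
  rw [dist_comm] at h2
  linarith [dist_triangle (stitchPoint (.inl (m, n))) (stitchPoint (.inr (m, n - 1)))
    (stitchPoint (.inl (m + 1, n - 1)))]

theorem dist_horizontal_le (m n p : ℤ) :
    dist (stitchPoint (.inl (m, n))) (stitchPoint (.inl (p, n))) ≤ 2 * |(p - m : ℝ)| :=
  dist_le_mul_abs_sub (f := fun i => stitchPoint (.inl (i, n)))
    (fun i => dist_horizontal_succ i n) m p

/-- The path climbs a column of vertical stitches. The additive 2√2 pays for stepping onto that
column and off it again. -/
theorem dist_vertical_le (m n q : ℤ) :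
    dist (stitchPoint (.inl (m, n))) (stitchPoint (.inl (m, q))) ≤
      2 * |(q - n : ℝ)| + 2 * √2 := by
  have h1 := dist_horizontal_vertical_le (m := m) (n := n) (m' := m) (n' := n) (s := 1) (t := 1)
    (by norm_num) (by norm_num) (by simp) (by simp)
  have h2 := dist_horizontal_vertical_le (m := m) (n := q) (m' := m) (n' := q) (s := 1) (t := 1)
    (by norm_num) (by norm_num) (by simp) (by simp)
  have h3 := dist_le_mul_abs_sub (f := fun i => stitchPoint (.inr (m, i)))
    (fun i => dist_vertical_succ m i) n q
  rw [dist_comm] at h2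
  linarith [dist_triangle4 (stitchPoint (.inl (m, n))) (stitchPoint (.inr (m, n)))
    (stitchPoint (.inr (m, q))) (stitchPoint (.inl (m, q)))]

theorem dist_diagonal_le (m n k l : ℤ) (h : l = k ∨ l = -k) :
    dist (stitchPoint (.inl (m, n))) (stitchPoint (.inl (m + k, n + l))) ≤
      2 * √2 * |(k : ℝ)| := by
  rcases h with rfl | rfl
  · simpa using dist_le_mul_abs_sub (f := fun i => stitchPoint (.inl (m + i, n + i)))
      (fun i => by simpa only [add_assoc] using dist_diagonal_succ (m + i) (n + i)) 0 l
  · simpa [sub_eq_add_neg] using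
      dist_le_mul_abs_sub (f := fun i => stitchPoint (.inl (m + i, n - i)))
      (fun i => by simpa only [add_assoc, sub_sub] using dist_antidiagonal_succ (m + i) (n - i)) 0 k

/-- Giving `k` the sign of `p` makes the diagonal part of a path reduce the longer coordinate
instead of lengthening it. -/
theorem exists_eq_or_eq_neg_abs_sub {p q : ℤ} (h : |q| ≤ |p|) :
    ∃ k : ℤ, (k = q ∨ k = -q) ∧ |p - k| = |p| - |q| := by
  by_cases hs : 0 ≤ p ∧ 0 ≤ q ∨ p ≤ 0 ∧ q ≤ 0
  · exact ⟨q, Or.inl rfl, by grind⟩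
  · exact ⟨-q, Or.inr rfl, by grind⟩

theorem dist_stitchPoint_le_F (m n m' n' : ℤ) :
    dist (stitchPoint (.inl (m, n))) (stitchPoint (.inl (m', n'))) ≤
      F (stitchCenter (.inl (m, n)) - stitchCenter (.inl (m', n'))) + 2 * √2 := by
  obtain ⟨p, rfl⟩ : ∃ p, m' = m + p := ⟨m' - m, by ring⟩
  obtain ⟨q, rfl⟩ : ∃ q, n' = n + q := ⟨n' - n, by ring⟩
  have hF := F_le_iff.1 (le_refl (F (stitchCenter (.inl (m, n)) -
    stitchCenter (.inl (m + p, n + q)))))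
  have e0 : (stitchCenter (.inl (m, n)) - stitchCenter (.inl (m + p, n + q))) 0 = -(3 * p) := by
    simp [stitchCenter]; ring
  have e1 : (stitchCenter (.inl (m, n)) - stitchCenter (.inl (m + p, n + q))) 1 = -(3 * q) := by
    simp [stitchCenter]; ring
  simp only [e0, e1, abs_neg, abs_mul, abs_of_nonneg (zero_le_three (α := ℝ))] at hF
  have hr := Real.sqrt_nonneg 2
  -- Diagonal steps use up the shorter coordinate, straight steps the rest. For |q| ≤ |p| the cost
  -- 2√2|q| + 2(|p| - |q|) is exactly `F`; only the vertical case needs the additive constant.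
  rcases le_total |q| |p| with h | h
  · obtain ⟨k, hk, hpk⟩ := exists_eq_or_eq_neg_abs_sub h
    have h1 := dist_diagonal_le m n k q (by omega)
    have h2 := dist_horizontal_le (m + k) (n + q) (m + p)
    have e2 : |(k : ℝ)| = |(q : ℝ)| := by rcases hk with rfl | rfl <;> simp
    have e3 : |(((m + p : ℤ) : ℝ) - (m + k : ℤ))| = |(p : ℝ)| - |(q : ℝ)| := by
      push_cast
      rw [add_sub_add_left_eq_sub]
      exact_mod_cast hpk
    rw [e2] at h1
    rw [e3] at h2
    linarith [dist_triangle (stitchPoint (.inl (m, n))) (stitchPoint (.inl (m + k, n + q)))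
      (stitchPoint (.inl (m + p, n + q)))]
  · obtain ⟨k, hk, hpk⟩ := exists_eq_or_eq_neg_abs_sub h
    have h1 := dist_diagonal_le m n p k (by omega)
    have h2 := dist_vertical_le (m + p) (n + k) (n + q)
    have e3 : |(((n + q : ℤ) : ℝ) - (n + k : ℤ))| = |(q : ℝ)| - |(p : ℝ)| := by
      push_cast
      rw [add_sub_add_left_eq_sub]
      exact_mod_cast hpk
    rw [e3] at h2
    linarith [dist_triangle (stitchPoint (.inl (m, n))) (stitchPoint (.inl (m + p, n + k)))
      (stitchPoint (.inl (m + p, n + q)))]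

theorem exists_int_abs_sub_le (t : ℝ) : ∃ m : ℤ, |t - 3 * m| ≤ 3 / 2 := by
  refine ⟨round (t / 3), ?_⟩
  have := abs_le.1 (abs_sub_round (t / 3))
  rw [abs_le]
  constructor <;> linarith

theorem exists_stitchPoint_near (x : EuclideanSpace ℝ (Fin 2)) : ∃ m n : ℤ,
    dist (checkered.proj x) (stitchPoint (.inl (m, n))) ≤ 1.81 ∧
      F (x - stitchCenter (.inl (m, n))) ≤ √2 := by
  obtain ⟨m, hm⟩ := exists_int_abs_sub_le (x 0)
  obtain ⟨n, hn⟩ := exists_int_abs_sub_le (x 1)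
  refine ⟨m, n, ?_, ?_⟩
  -- The first coordinate of `x` is clamped to the stitch. The offsets are then at most 1 and 3/2,
  -- and √(13/4) < 1.81.
  · have hz : !₂[max (3 * m - 1 / 2 : ℝ) (min (3 * m + 1 / 2) (x 0)), (3 * n : ℝ)] ∈
        checkeredStitch (.inl (m, n)) := by
      refine ⟨⟨le_max_left _ _, max_le (by linarith) (min_le_left _ _)⟩, rfl⟩
    rw [← proj_eq_stitchPoint hz]
    refine (dist_proj_le _ _).trans
      (dist_le_of_abs_le (a := 1) (b := 3 / 2) (by norm_num) ?_ hn (by norm_num))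
    simp only [Matrix.cons_val_zero]
    rw [abs_le] at hm ⊢
    rcases max_cases (3 * m - 1 / 2 : ℝ) (min (3 * m + 1 / 2) (x 0)) with h | h <;>
      rcases min_cases (3 * m + 1 / 2 : ℝ) (x 0) with h' | h' <;>
      constructor <;> linarith
  · obtain ⟨h1, h2⟩ := sqrt_two_bounds
    rw [F_le_iff]
    have b : 0 ≤ 2 * √2 - 2 := by linarith
    have b0 := mul_le_mul_of_nonneg_left hm b
    have b1 := mul_le_mul_of_nonneg_left hn b
    simp only [stitchCenter, PiLp.sub_apply, Matrix.cons_val_zero, Matrix.cons_val_one]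
    constructor <;> linarith

theorem pseudoDist_le_F_sub (x x' : EuclideanSpace ℝ (Fin 2)) :
    checkered.pseudoDist x x' ≤ F (x - x') + (3.62 + 4 * √2) := by
  obtain ⟨m, n, h1, h2⟩ := exists_stitchPoint_near x
  obtain ⟨m', n', h1', h2'⟩ := exists_stitchPoint_near x'
  have h3 := dist_stitchPoint_le_F m n m' n'
  have h4 := dist_triangle4 (checkered.proj x) (stitchPoint (.inl (m, n)))
    (stitchPoint (.inl (m', n'))) (checkered.proj x')
  have h5 := F_sub_le (stitchCenter (.inl (m, n))) x (stitchCenter (.inl (m', n')))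
  have h6 := F_sub_le x x' (stitchCenter (.inl (m', n')))
  rw [F_sub_comm] at h2
  rw [dist_comm] at h1'
  unfold Pattern.pseudoDist
  linarith

theorem abs_pseudoDist_sub_F_le (x x' : EuclideanSpace ℝ (Fin 2)) :
    |checkered.pseudoDist x x' - F (x - x')| ≤ (13 + 11 * √2) / 3 := by
  have h1 := F_sub_le_pseudoDist x x'
  have h2 := pseudoDist_le_F_sub x x'
  obtain ⟨h3, h4⟩ := sqrt_two_bounds
  rw [abs_le]
  constructor <;> linarith

/-! ### From coarse isometries to pointed Gromov–Hausdorff convergence -/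

section CoarseIsometry

variable {X E : Type*} [MetricSpace X] [NormedAddCommGroup E] [NormedSpace ℝ E]

/-- If `g` is an isometry up to `ε` and almost onto a normed space, then the balls in both spaces
are close to each other. -/
theorem ghDist_closedBall_le {g : X → E} {ε r : ℝ} (hε : 0 ≤ ε) (hr : 0 < r) (hεr : 2 * ε ≤ r)
    {x₀ : X} (hg₀ : g x₀ = 0) (hg : ∀ a b, |dist a b - dist (g a) (g b)| ≤ ε)
    (hd : ∀ y, ∃ a, dist y (g a) ≤ ε)
    [Nonempty (Metric.closedBall x₀ r)] [CompactSpace (Metric.closedBall x₀ r)]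
    [Nonempty (Metric.closedBall (0 : E) r)] [CompactSpace (Metric.closedBall (0 : E) r)] :
    GromovHausdorff.ghDist (Metric.closedBall x₀ r) (Metric.closedBall (0 : E) r) ≤ 6 * ε := by
  have hg' : ∀ a, |dist a x₀ - ‖g a‖| ≤ ε := fun a => by
    simpa [hg₀] using hg a x₀
  have hnorm : ∀ a ∈ Metric.closedBall x₀ r, ‖g a‖ ≤ r + ε := fun a ha => by
    have := (abs_le.1 (hg' a)).1
    linarith [Metric.mem_closedBall.1 ha]
  have hpos : 0 < r + ε := by linarith
  -- `g` may map the ball of radius `r` slightly outside; shrinking by `c` brings the image back and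
  -- moves its points by at most `ε`.
  set c := r / (r + ε) with hc
  have hc0 : 0 ≤ c := by positivity
  have hc1 : (1 - c) * (r + ε) = ε := by rw [hc]; field_simp; ring
  have hc2 : 0 ≤ 1 - c := by
    have : c ≤ 1 := (div_le_one hpos).2 (by linarith)
    linarith
  have hcr : c * (r + ε) = r := div_mul_cancel₀ _ hpos.ne'
  have hmem : ∀ a ∈ Metric.closedBall x₀ r, c • g a ∈ Metric.closedBall (0 : E) r := by
    intro a ha
    rw [mem_closedBall_zero_iff, norm_smul, Real.norm_of_nonneg hc0, ← hcr]
    exact mul_le_mul_of_nonneg_left (hnorm a ha) hc0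
  -- The distortion 3ε is `ε` from `g` plus 2ε from shrinking a set of diameter at most 2(r + ε).
  -- The resulting bound is 0 + 3ε/2 + 4ε ≤ 6ε.
  have key := GromovHausdorff.ghDist_le_of_approx_subsets (X := Metric.closedBall x₀ r)
    (Y := Metric.closedBall (0 : E) r) (s := Set.univ)
    (fun a => ⟨c • g a.1.1, hmem _ a.1.2⟩) (ε₁ := 0) (ε₂ := 3 * ε) (ε₃ := 4 * ε)
    (fun a => ⟨a, Set.mem_univ _, (dist_self a).le⟩) ?_ ?_
  · linarith
  · rintro ⟨y, hy⟩
    rw [mem_closedBall_zero_iff] at hy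
    -- Moving `y` inwards by up to 2ε leaves one `ε` for approximating by `g a` and another for
    -- comparing ‖g a‖ with the distance from `a` to `x₀`, so that `a` stays in the ball.
    set t := 1 - 2 * ε / r with ht
    have ht1 : (1 - t) * r = 2 * ε := by rw [ht]; field_simp; ring
    have ht0 : 0 ≤ t := by rw [ht, sub_nonneg, div_le_one hr]; exact hεr
    have ht2 : 0 ≤ 1 - t := by rw [ht, sub_sub_cancel]; positivity
    obtain ⟨a, ha⟩ := hd (t • y)
    have hty : ‖t • y‖ ≤ r - 2 * ε := by
      rw [norm_smul, Real.norm_of_nonneg ht0]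
      nlinarith
    have hga : ‖g a‖ ≤ r - ε := by
      have h1 := norm_le_norm_add_norm_sub' (g a) (t • y)
      rw [← dist_eq_norm, dist_comm] at h1
      linarith
    have hmem_a : a ∈ Metric.closedBall x₀ r := by
      have := (abs_le.1 (hg' a)).2
      rw [Metric.mem_closedBall]
      linarith
    refine ⟨⟨⟨a, hmem_a⟩, Set.mem_univ _⟩, ?_⟩
    change dist y (c • g a) ≤ 4 * ε
    have h1 : dist y (t • y) ≤ 2 * ε := by
      have : y - t • y = (1 - t) • y := by module
      rw [dist_eq_norm, this, norm_smul, Real.norm_of_nonneg ht2, ← ht1]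
      exact mul_le_mul_of_nonneg_left hy ht2
    have h2 : dist (g a) (c • g a) ≤ ε := by
      have : g a - c • g a = (1 - c) • g a := by rw [sub_smul, one_smul]
      rw [dist_eq_norm, this, norm_smul, Real.norm_of_nonneg hc2]
      exact (mul_le_mul_of_nonneg_left (hnorm a hmem_a) hc2).trans_eq hc1
    linarith [dist_triangle4 y (t • y) (g a) (c • g a)]
  · rintro ⟨⟨a, ha⟩, -⟩ ⟨⟨b, hb⟩, -⟩
    change |dist a b - dist (c • g a) (c • g b)| ≤ 3 * ε
    have h1 : dist (c • g a) (c • g b) = c * dist (g a) (g b) := by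
      rw [dist_smul₀, Real.norm_of_nonneg hc0]
    have h2 : dist (g a) (g b) ≤ 2 * (r + ε) := by
      rw [dist_eq_norm]
      linarith [norm_sub_le (g a) (g b), hnorm a ha, hnorm b hb]
    have h3 := mul_le_mul_of_nonneg_left h2 hc2
    have h4 := mul_nonneg hc2 (dist_nonneg (x := g a) (y := g b))
    have h5 := abs_le.1 (hg a b)
    rw [h1, abs_le]
    constructor <;> linarith

instance properSpace_rescaled [ProperSpace X] (R : {R : ℝ // 0 < R}) :
    ProperSpace (Rescaled X R) where
  isCompact_closedBall x r := by
    let f : X → Rescaled X R := fun a => a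
    have hf : Continuous f := by
      refine (LipschitzWith.of_dist_le_mul (K := ⟨(R : ℝ)⁻¹, inv_nonneg.2 R.2.le⟩)
        fun a b => ?_).continuous
      change dist a b / (R : ℝ) ≤ (R : ℝ)⁻¹ * dist a b
      rw [div_eq_inv_mul]
    convert (isCompact_closedBall (α := X) x (r * R)).image hf
    ext a
    constructor
    · intro ha
      refine ⟨a, ?_, rfl⟩
      exact (div_le_iff₀ R.2).1 (Metric.mem_closedBall.1 ha)
    · rintro ⟨a, ha, rfl⟩
      exact (div_le_iff₀ R.2).2 (Metric.mem_closedBall.1 ha)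

theorem ptGHConverges_rescaled_of_coarse_isometry [ProperSpace X] [ProperSpace E] {g : X → E}
    {C : ℝ} (hg : ∀ a b, |dist a b - dist (g a) (g b)| ≤ C) (hd : ∀ y, ∃ a, dist y (g a) ≤ C)
    (x₀ : X) {R : ℕ → {R : ℝ // 0 < R}} (hR : Tendsto (fun n => (R n : ℝ)) atTop atTop) :
    PtGHConverges (fun n => Rescaled X (R n)) (fun _ => x₀) E 0 := by
  intro r hr
  have hC : 0 ≤ C := (abs_nonneg _).trans (hg x₀ x₀)
  have hcX : ∀ n, CompactSpace (Metric.closedBall (α := Rescaled X (R n)) x₀ r) := fun n =>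
    isCompact_iff_compactSpace.1 (isCompact_closedBall (α := Rescaled X (R n)) x₀ r)
  have hcE : CompactSpace (Metric.closedBall (0 : E) r) :=
    isCompact_iff_compactSpace.1 (isCompact_closedBall _ _)
  have hnX : ∀ n, Nonempty (Metric.closedBall (α := Rescaled X (R n)) x₀ r) := fun n =>
    ⟨⟨x₀, Metric.mem_closedBall_self hr.le⟩⟩
  have hnE : Nonempty (Metric.closedBall (0 : E) r) := ⟨⟨0, Metric.mem_closedBall_self hr.le⟩⟩
  refine ⟨hnX, hcX, hnE, hcE, ?_⟩
  have hlim : Tendsto (fun n => C / (R n : ℝ)) atTop (𝓝 0) := hR.const_div_atTop C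
  have hlim' : Tendsto (fun n => 6 * (C / (R n : ℝ))) atTop (𝓝 0) := by
    simpa using hlim.const_mul 6
  refine squeeze_zero' (Eventually.of_forall fun n => dist_nonneg) ?_ hlim'
  filter_upwards [hlim.eventually (ge_mem_nhds (half_pos hr))] with n hn
  have hRn : 0 < (R n : ℝ) := (R n).2
  have hs : ∀ u v : E, dist ((R n : ℝ)⁻¹ • u) ((R n : ℝ)⁻¹ • v) = dist u v / R n := fun u v => by
    rw [dist_smul₀, Real.norm_of_nonneg (inv_nonneg.2 hRn.le), div_eq_inv_mul]
  -- Translating and rescaling `g` sends `x₀` to 0 and turns the error `C` into `C / R n`.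
  refine ghDist_closedBall_le (X := Rescaled X (R n))
    (g := fun a => (R n : ℝ)⁻¹ • (g a - g x₀)) (by positivity) hr (by linarith) (by simp) ?_ ?_
  · intro a b
    change |dist (α := X) a b / R n - _| ≤ _
    rw [hs, dist_sub_right, ← sub_div, abs_div, abs_of_pos hRn]
    exact div_le_div_of_nonneg_right (hg a b) hRn.le
  · intro y
    obtain ⟨a, ha⟩ := hd ((R n : ℝ) • y + g x₀)
    refine ⟨a, ?_⟩
    have e : y = (R n : ℝ)⁻¹ • ((R n : ℝ) • y + g x₀ - g x₀) := by
      rw [add_sub_cancel_right, inv_smul_smul₀ hRn.ne']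
    rw [e, hs, dist_sub_right]
    exact div_le_div_of_nonneg_right ha hRn.le

end CoarseIsometry

/-! ### Uniqueness of pointed limits -/

section Uniqueness

theorem GHConverges.nonempty_isometryEquiv {A : ℕ → Type*} [∀ n, MetricSpace (A n)]
    {B B' : Type*} [MetricSpace B] [MetricSpace B'] (h : GHConverges A B)
    (h' : GHConverges A B') : Nonempty (B ≃ᵢ B') := by
  obtain ⟨hn, hc, hnB, hcB, hB⟩ := h
  obtain ⟨_, _, hnB', hcB', hlimit⟩ := h'
  rw [← GromovHausdorff.toGHSpace_eq_toGHSpace_iff_isometryEquiv]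
  exact tendsto_nhds_unique (tendsto_iff_dist_tendsto_zero.2 hB)
    (tendsto_iff_dist_tendsto_zero.2 hlimit)

/-- The centre of a ball in a normed space is the only point whose distance to all points of the
ball is at most the radius. -/
theorem eq_zero_of_forall_dist_le {E : Type*} [NormedAddCommGroup E] [NormedSpace ℝ E] {r : ℝ}
    (hr : 0 < r) {p : E} (hp : ∀ q ∈ Metric.closedBall (0 : E) r, dist q p ≤ r) : p = 0 := by
  by_contra hne
  have hpos : 0 < ‖p‖ := norm_pos_iff.2 hne
  -- The point of the sphere opposite to `p` has distance r + ‖p‖ from it.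
  have h := hp (-(r / ‖p‖) • p) ?_
  · have e : -(r / ‖p‖) • p - p = (-(r / ‖p‖ + 1)) • p := by
      rw [neg_add, add_smul, neg_one_smul, sub_eq_add_neg]
    rw [dist_eq_norm, e, norm_smul, norm_neg, Real.norm_of_nonneg (by positivity), add_mul,
      div_mul_cancel₀ _ hpos.ne'] at h
    linarith
  · rw [mem_closedBall_zero_iff, norm_smul, norm_neg, Real.norm_of_nonneg (by positivity),
      div_mul_cancel₀ _ hpos.ne']

/-- One fixed ultrafilter gives limits at all points simultaneously, which replaces the extraction
of a diagonal subsequence. -/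
theorem exists_tendsto_hyperfilter {Y : Type*} [MetricSpace Y] [ProperSpace Y] {u : ℕ → Y}
    {y₀ : Y} {r : ℝ} (h : ∀ᶠ n in atTop, dist (u n) y₀ ≤ r) :
    ∃ y, Tendsto u (hyperfilter ℕ) (𝓝 y) := by
  obtain ⟨y, -, hy⟩ := (isCompact_closedBall y₀ r).ultrafilter_le_nhds' ((hyperfilter ℕ).map u)
    (Nat.hyperfilter_le_atTop h)
  exact ⟨y, hy⟩

/-- Two proper pointed metric spaces are isometric if their balls of the same radius are, by
isometries that preserve the base points. -/
theorem nonempty_isometryEquiv_of_closedBalls {X Y : Type*} [MetricSpace X] [MetricSpace Y]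
    [ProperSpace X] [ProperSpace Y] (x₀ : X) (y₀ : Y)
    (h : ∀ n : ℕ, ∃ f : X → Y, f x₀ = y₀ ∧
      (∀ x ∈ Metric.closedBall x₀ (n + 1 : ℝ), ∀ x' ∈ Metric.closedBall x₀ (n + 1 : ℝ),
        dist (f x) (f x') = dist x x') ∧
      ∀ y ∈ Metric.closedBall y₀ (n + 1 : ℝ), ∃ x ∈ Metric.closedBall x₀ (n + 1 : ℝ), f x = y) :
    Nonempty (X ≃ᵢ Y) := by
  choose φ h0 hiso hsurj using h
  have hball : ∀ x : X, ∀ᶠ n : ℕ in atTop, x ∈ Metric.closedBall x₀ (n + 1 : ℝ) := fun x => by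
    filter_upwards [tendsto_natCast_atTop_atTop.eventually_ge_atTop (dist x x₀)] with n hn
    rw [Metric.mem_closedBall]
    linarith
  have hball' : ∀ y : Y, ∀ᶠ n : ℕ in atTop, y ∈ Metric.closedBall y₀ (n + 1 : ℝ) := fun y => by
    filter_upwards [tendsto_natCast_atTop_atTop.eventually_ge_atTop (dist y y₀)] with n hn
    rw [Metric.mem_closedBall]
    linarith
  have hx₀ : ∀ n : ℕ, x₀ ∈ Metric.closedBall x₀ (n + 1 : ℝ) := fun n =>
    Metric.mem_closedBall_self (by positivity)
  -- No compatibility between the maps `φ n` is needed: they fix the base points, so the images of a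
  -- given point are eventually bounded.
  have hlim : ∀ x, ∃ y, Tendsto (fun n => φ n x) (hyperfilter ℕ) (𝓝 y) := fun x => by
    refine exists_tendsto_hyperfilter (y₀ := y₀) (r := dist x x₀) ?_
    filter_upwards [hball x] with n hn
    rw [← hiso n x hn x₀ (hx₀ n), h0]
  choose f hf using hlim
  have hfiso : Isometry f := by
    refine Isometry.of_dist_eq fun x x' => ?_
    refine tendsto_nhds_unique ((hf x).dist (hf x')) ?_
    refine tendsto_const_nhds.congr' (Nat.hyperfilter_le_atTop ?_)
    filter_upwards [hball x, hball x'] with n hn hn'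
    exact (hiso n x hn x' hn').symm
  have hfsurj : Function.Surjective f := by
    intro y
    -- A limit of preimages of `y` will be a preimage under the limit map. The default `x₀` occurs
    -- only for the finitely many balls that miss `y`.
    have hex : ∀ n : ℕ, ∃ x, y ∈ Metric.closedBall y₀ (n + 1 : ℝ) →
        x ∈ Metric.closedBall x₀ (n + 1 : ℝ) ∧ φ n x = y := fun n => by
      by_cases hy : y ∈ Metric.closedBall y₀ (n + 1 : ℝ)
      · obtain ⟨x, hx⟩ := hsurj n y hy
        exact ⟨x, fun _ => hx⟩
      · exact ⟨x₀, fun h => absurd h hy⟩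
    choose ψ hψ using hex
    obtain ⟨x, hx⟩ : ∃ x, Tendsto ψ (hyperfilter ℕ) (𝓝 x) := by
      refine exists_tendsto_hyperfilter (y₀ := x₀) (r := dist y y₀) ?_
      filter_upwards [hball' y] with n hn
      rw [← hiso n _ (hψ n hn).1 x₀ (hx₀ n), h0, (hψ n hn).2]
    refine ⟨x, ?_⟩
    refine tendsto_nhds_unique (hf x) (tendsto_iff_dist_tendsto_zero.2 ?_)
    refine (tendsto_iff_dist_tendsto_zero.1 hx).congr' (Nat.hyperfilter_le_atTop ?_)
    filter_upwards [hball x, hball' y] with n hn hn'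
    rw [dist_comm, ← hiso n x hn _ (hψ n hn').1, (hψ n hn').2]
  exact ⟨IsometryEquiv.mk' f (Function.surjInv hfsurj) (Function.surjInv_eq hfsurj) hfiso⟩

/-- A pointed Gromov-Hausdorff limit that is a proper normed space is unique among all metric
spaces. -/
theorem PtGHConverges.nonempty_isometryEquiv {X : ℕ → Type*} [∀ n, MetricSpace (X n)]
    {x : ∀ n, X n} {Y E : Type*} [MetricSpace Y] [NormedAddCommGroup E] [NormedSpace ℝ E]
    [ProperSpace E] {y₀ : Y} (hY : PtGHConverges X x Y y₀) (hE : PtGHConverges X x E 0) :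
    Nonempty (Y ≃ᵢ E) := by
  -- Properness of `Y` is part of the convergence, which requires the balls around `y₀` to be
  -- compact; every other closed ball lies in one of these.
  have : ProperSpace Y := by
    refine ProperSpace.of_isCompact_closedBall_of_le 1 fun y r hr => ?_
    obtain ⟨_, _, _, hc, _⟩ := hY (r + dist y y₀) (by positivity)
    refine (isCompact_iff_compactSpace.2 hc).of_isClosed_subset Metric.isClosed_closedBall ?_
    exact Metric.closedBall_subset_closedBall' le_rfl
  have key : Nonempty (E ≃ᵢ Y) := by
    refine nonempty_isometryEquiv_of_closedBalls (0 : E) y₀ fun n => ?_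
    have hn : (0 : ℝ) < n + 1 := by positivity
    obtain ⟨e⟩ := (hE _ hn).nonempty_isometryEquiv (hY _ hn)
    -- Convergence of balls as unpointed spaces gives an isometry with no control of base points.
    -- But `y₀` is within n + 1 of its whole ball, and in the normed ball only the centre has this
    -- property.
    have he : (e.symm ⟨y₀, Metric.mem_closedBall_self hn.le⟩ : E) = 0 := by
      refine eq_zero_of_forall_dist_le hn fun q hq => ?_
      have h1 : dist (⟨q, hq⟩ : Metric.closedBall (0 : E) (n + 1 : ℝ))
          (e.symm ⟨y₀, Metric.mem_closedBall_self hn.le⟩) ≤ n + 1 := by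
        rw [← e.dist_eq, e.apply_symm_apply]
        exact (e ⟨q, hq⟩).2
      exact h1
    classical
    refine ⟨fun z => if hz : z ∈ Metric.closedBall (0 : E) (n + 1 : ℝ) then e ⟨z, hz⟩ else y₀,
      ?_, fun z hz z' hz' => ?_, fun y hy => ?_⟩
    · simp only [dif_pos (Metric.mem_closedBall_self hn.le : (0 : E) ∈ _)]
      have : (⟨0, Metric.mem_closedBall_self hn.le⟩ : Metric.closedBall (0 : E) (n + 1 : ℝ)) =
          e.symm ⟨y₀, Metric.mem_closedBall_self hn.le⟩ := Subtype.ext he.symm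
      rw [this, e.apply_symm_apply]
    · simp only [dif_pos hz, dif_pos hz']
      exact e.dist_eq ⟨z, hz⟩ ⟨z', hz'⟩
    · refine ⟨e.symm ⟨y, hy⟩, (e.symm ⟨y, hy⟩).2, ?_⟩
      simp only [dif_pos (e.symm ⟨y, hy⟩).2, Subtype.coe_eta, e.apply_symm_apply]
  exact key.map IsometryEquiv.symm

end Uniqueness

/-! ### The checkered space and its tangent cone -/

section Checkered

instance finiteDimensional_FPlane : FiniteDimensional ℝ FPlane :=
  inferInstanceAs (FiniteDimensional ℝ (EuclideanSpace ℝ (Fin 2)))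

instance properSpace_FPlane : ProperSpace FPlane := FiniteDimensional.proper ℝ FPlane

theorem continuous_proj : Continuous checkered.proj :=
  (LipschitzWith.of_dist_le_mul (K := 1) fun x y => by
    simpa using dist_proj_le x y).continuous

theorem dist_le_mul_F (x y : EuclideanSpace ℝ (Fin 2)) : dist x y ≤ 3 * F (x - y) := by
  have h := F_le_iff.1 (le_refl (F (x - y)))
  have h0 := F_nonneg (x - y)
  have h1 : 0 ≤ 2 * √2 - 2 := by linarith [sqrt_two_bounds.1]
  have p0 := mul_nonneg h1 (abs_nonneg ((x - y) 0))
  have p1 := mul_nonneg h1 (abs_nonneg ((x - y) 1))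
  refine dist_le_of_abs_le (a := 3 / 2 * F (x - y)) (b := 3 / 2 * F (x - y)) (by linarith) ?_ ?_
    (by nlinarith)
  · rw [← PiLp.sub_apply]; linarith
  · rw [← PiLp.sub_apply]; linarith

instance properSpace_checkered : ProperSpace CheckeredSpace where
  isCompact_closedBall a r := by
    obtain ⟨v, rfl⟩ : ∃ v, checkered.proj v = a := Quotient.exists_rep a
    have hsurj : Function.Surjective checkered.proj := Quotient.exists_rep
    rw [← Set.image_preimage_eq (Metric.closedBall (checkered.proj v) r) hsurj]
    -- The preimage of the ball is closed, and bounded because the smocked distance dominates `F` -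
    -- 2; hence it is compact in the plane.
    refine IsCompact.image ?_ continuous_proj
    refine (isCompact_closedBall v (3 * (r + 2))).of_isClosed_subset
      (Metric.isClosed_closedBall.preimage continuous_proj) fun x hx => ?_
    have h1 : checkered.pseudoDist x v ≤ r := hx
    have h2 := F_sub_le_pseudoDist x v
    rw [Metric.mem_closedBall]
    linarith [dist_le_mul_F x v]

/-- A choice of representatives of the points of the checkered smocked space. -/
noncomputable def representative (a : CheckeredSpace) : EuclideanSpace ℝ (Fin 2) :=
  Quotient.out a

theorem proj_representative (a : CheckeredSpace) : checkered.proj (representative a) = a :=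
  Quotient.out_eq a

theorem abs_dist_sub_F_representative_le (a b : CheckeredSpace) :
    |dist a b - F (representative a - representative b)| ≤ (13 + 11 * √2) / 3 := by
  have h := abs_pseudoDist_sub_F_le (representative a) (representative b)
  rwa [Pattern.pseudoDist, proj_representative, proj_representative] at h

theorem exists_F_sub_representative_le (y : EuclideanSpace ℝ (Fin 2)) :
    ∃ a, F (y - representative a) ≤ (13 + 11 * √2) / 3 := by
  refine ⟨checkered.proj y, ?_⟩
  have h := F_sub_le_of_proj_eq (proj_representative (checkered.proj y)).symm
  linarith [sqrt_two_bounds.1]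

theorem ptGHConverges_checkered (x₀ : CheckeredSpace) {R : ℕ → {R : ℝ // 0 < R}}
    (hR : Tendsto (fun n => (R n : ℝ)) atTop atTop) :
    PtGHConverges (fun n => Rescaled CheckeredSpace (R n)) (fun _ => x₀) FPlane 0 := by
  let g : CheckeredSpace → FPlane := representative
  refine ptGHConverges_rescaled_of_coarse_isometry (g := g) (C := (13 + 11 * √2) / 3)
    (fun a b => ?_) (fun y => ?_) x₀ hR
  · have e : dist (g a) (g b) = F (representative a - representative b) := FPlane.dist_eq _ _
    rw [e]
    exact abs_dist_sub_F_representative_le a b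
  · obtain ⟨a, ha⟩ := exists_F_sub_representative_le y
    exact ⟨a, (FPlane.dist_eq y (representative a)).trans_le ha⟩

theorem not_isBounded_checkered : ¬ Bornology.IsBounded (Set.univ : Set CheckeredSpace) := by
  intro h
  obtain ⟨C, hC⟩ := Metric.isBounded_iff.1 h
  -- On the first axis `F` is 2/3 of the absolute value, so this point has `F`-norm |C| + 3, which
  -- exceeds C + 2.
  have h1 : checkered.pseudoDist !₂[3 / 2 * (|C| + 3), 0] 0 ≤ C :=
    hC (Set.mem_univ _) (Set.mem_univ _)
  have h2 := F_sub_le_pseudoDist !₂[3 / 2 * (|C| + 3), 0] 0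
  have h3 := (F_le_iff.1 (le_refl (F (!₂[3 / 2 * (|C| + 3), 0] - 0)))).1
  have h4 : 3 / 2 * (|C| + 3) ≤ |3 / 2 * (|C| + 3)| := le_abs_self _
  simp only [sub_zero, Matrix.cons_val_zero, Matrix.cons_val_one, abs_zero, mul_zero, add_zero]
    at h2 h3
  linarith [le_abs_self C]

theorem isTangentConeAtInfinity_FPlane : IsTangentConeAtInfinity CheckeredSpace FPlane := by
  refine ⟨inferInstance, not_isBounded_checkered, fun n => ⟨n + 1, by positivity⟩,
    checkered.proj 0, 0, ?_, ptGHConverges_checkered _ ?_⟩ <;>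
  exact tendsto_atTop_add_const_right _ _ tendsto_natCast_atTop_atTop

end Checkered

end Smocking

theorem mainTheorem1 :
    (∀ x x' : EuclideanSpace ℝ (Fin 2),
      |Smocking.checkered.pseudoDist x x' - Smocking.F (x - x')| ≤ (13 + 11 * √2) / 3) ∧
    (∀ (x₀ : Smocking.CheckeredSpace) (R : ℕ → {R : ℝ // 0 < R}),
      Filter.Tendsto (fun n => (R n : ℝ)) Filter.atTop Filter.atTop →
      Smocking.PtGHConverges (fun n => Smocking.Rescaled Smocking.CheckeredSpace (R n))
        (fun _ => x₀) Smocking.FPlane 0) ∧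
    Smocking.IsTangentConeAtInfinity Smocking.CheckeredSpace Smocking.FPlane ∧
    (∀ (Y : Type*) [MetricSpace Y],
      Smocking.IsTangentConeAtInfinity Smocking.CheckeredSpace Y →
        Nonempty (Y ≃ᵢ Smocking.FPlane)) := by
  refine ⟨Smocking.abs_pseudoDist_sub_F_le, fun x₀ R hR => Smocking.ptGHConverges_checkered x₀ hR,
    Smocking.isTangentConeAtInfinity_FPlane, ?_⟩
  rintro Y _ ⟨-, -, R, x₀, y₀, hR, hY⟩
  exact hY.nonempty_isometryEquiv (Smocking.ptGHConverges_checkered x₀ hR)
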